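/- Let $n\ge 0$, $q\ge 1$, and let $w=w_1w_2\cdots w_n$ be a word in the alphabet $\{1,2,\ldots,q\}$. Let $\mathrm{LIS}(w)$ (resp. $\mathrm{LDS}(w)$) be the length of the longest strictly increasing (resp. strictly decreasing) subsequence of $w$. The $0$-Hecke monoid $\mathcal H_{0,q}$ is the quotient of the free monoid on $\{1,\ldots,q\}$ by the relations $ii\equiv i$ for all $i$, $iji\equiv jij$ for all $i,j$, and $ij\equiv ji$ for $|i-j|\ge 2$. For $\pi\in S_{q+1}$ let $\ell(\pi)$ be its Coxeter length, i.e. the least $k$ such that $\pi$ is a product of $k$ simple reflections $s_i=(i\ \ i{+}1)$, $1\le i\le q$; a reduced word of $\pi$ is a word $b_1\cdots b_k$ with $k=\ell(\pi)$ and $s_{b_1}\cdots s_{b_k}=\pi$. Let $W(w)\in S_{q+1}$ be the unique permutation $\pi$ such that $w\equiv b$ for every reduced word $b$ of $\pi$. Let $a,b$ be integers with $1\le a,b<q$. Then $$\sum_{i=1}^{a}\min(b,q+1-i)=\sum_{j=1}^{b}\min(a,q+1-j),$$ and if $\ell(W(w))$ exceeds this common value, then $\mathrm{LIS}(w)>a$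 or $\mathrm{LDS}(w)>b$. -/

import Mathlib

namespace HeckeES

/-! Letters of the alphabet `{1, …, q}` are represented by `Fin q` (the letter `k` by the element
of value `k - 1`), and `S_{q+1}` is the group of permutations of `Fin (q + 1)`. -/

/-- The defining relations of the `0`-Hecke monoid. -/
inductive HeckeRel (q : ℕ) : FreeMonoid (Fin q) → FreeMonoid (Fin q) → Prop
  | idem (i : Fin q) :
      HeckeRel q (FreeMonoid.of i * FreeMonoid.of i) (FreeMonoid.of i)
  | braid (i j : Fin q) :
      HeckeRel q (FreeMonoid.of i * FreeMonoid.of j * FreeMonoid.of i)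
        (FreeMonoid.of j * FreeMonoid.of i * FreeMonoid.of j)
  | comm (i j : Fin q) (h : (i : ℕ) + 2 ≤ j ∨ (j : ℕ) + 2 ≤ i) :
      HeckeRel q (FreeMonoid.of i * FreeMonoid.of j) (FreeMonoid.of j * FreeMonoid.of i)

/-- The `0`-Hecke monoid `ℋ_{0,q}`: words in `q` letters modulo the relations above. -/
abbrev HeckeMonoid (q : ℕ) : Type := PresentedMonoid (HeckeRel q)

/-- The class of a word in the `0`-Hecke monoid. -/
def heckeClass {q : ℕ} (w : List (Fin q)) : HeckeMonoid q :=
  PresentedMonoid.mk (HeckeRel q) (FreeMonoid.ofList w)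

/-- The simple reflection `s_i = (i  i+1)` in `S_{q+1}`. -/
def simpleRefl {q : ℕ} (i : Fin q) : Equiv.Perm (Fin (q + 1)) :=
  Equiv.swap i.castSucc i.succ

/-- The product `s_{b_1} s_{b_2} ⋯ s_{b_k}` in `S_{q+1}`. -/
def reflProd {q : ℕ} (b : List (Fin q)) : Equiv.Perm (Fin (q + 1)) :=
  (b.map simpleRefl).prod

/-- Coxeter length: the least number of simple reflections whose product is `π`
(the set is never empty, see `exists_reflProd_eq`). -/
noncomputable def coxeterLength {q : ℕ} (π : Equiv.Perm (Fin (q + 1))) : ℕ :=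
  sInf {k | ∃ b : List (Fin q), b.length = k ∧ reflProd b = π}

/-- `b` is a reduced word of `π`. -/
def IsReducedWord {q : ℕ} (b : List (Fin q)) (π : Equiv.Perm (Fin (q + 1))) : Prop :=
  reflProd b = π ∧ b.length = coxeterLength π

/-- `w` is a Hecke word for `π`: it is equivalent, in the `0`-Hecke monoid, to every reduced word
of `π`. -/
def IsHeckeWord {q : ℕ} (w : List (Fin q)) (π : Equiv.Perm (Fin (q + 1))) : Prop :=
  ∀ b : List (Fin q), IsReducedWord b π → heckeClass w = heckeClass b

/-! ### Every word is a Hecke word for exactly one permutation -/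

theorem heckeClass_append {q : ℕ} (v w : List (Fin q)) :
    heckeClass (v ++ w) = heckeClass v * heckeClass w := by
  simp [heckeClass, FreeMonoid.ofList_append]

theorem heckeClass_idem {q : ℕ} (i : Fin q) : heckeClass [i, i] = heckeClass [i] :=
  PresentedMonoid.mk_eq_mk_of_rel (HeckeRel.idem i)

theorem heckeClass_braid {q : ℕ} (i j : Fin q) : heckeClass [i, j, i] = heckeClass [j, i, j] :=
  PresentedMonoid.mk_eq_mk_of_rel (HeckeRel.braid i j)

theorem heckeClass_comm {q : ℕ} (i j : Fin q) (h : (i : ℕ) + 2 ≤ j ∨ (j : ℕ) + 2 ≤ i) :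
    heckeClass [i, j] = heckeClass [j, i] :=
  PresentedMonoid.mk_eq_mk_of_rel (HeckeRel.comm i j h)

theorem reflProd_append {q : ℕ} (v w : List (Fin q)) :
    reflProd (v ++ w) = reflProd v * reflProd w := by
  simp [reflProd]

theorem reflProd_singleton {q : ℕ} (i : Fin q) : reflProd [i] = simpleRefl i := by
  simp [reflProd]

theorem simpleRefl_mul_self {q : ℕ} (i : Fin q) : simpleRefl i * simpleRefl i = 1 :=
  Equiv.swap_mul_self _ _

theorem mul_simpleRefl_mul_self {q : ℕ} (π : Equiv.Perm (Fin (q + 1))) (i : Fin q) :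
    π * simpleRefl i * simpleRefl i = π := by
  rw [mul_assoc, simpleRefl_mul_self, mul_one]

theorem exists_reflProd_eq {q : ℕ} (π : Equiv.Perm (Fin (q + 1))) :
    ∃ b : List (Fin q), reflProd b = π := by
  have h : π ∈ Submonoid.closure
      (Set.range fun i : Fin q ↦ Equiv.swap i.castSucc i.succ) := by
    rw [Equiv.Perm.mclosure_swap_castSucc_succ]; trivial
  induction h using Submonoid.closure_induction with
  | mem x hx =>
    obtain ⟨i, rfl⟩ := hx
    exact ⟨[i], reflProd_singleton i⟩
  | one => exact ⟨[], rfl⟩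
  | mul x y _ _ hx hy =>
    obtain ⟨b, rfl⟩ := hx
    obtain ⟨c, rfl⟩ := hy
    exact ⟨b ++ c, reflProd_append b c⟩

theorem exists_isReducedWord {q : ℕ} (π : Equiv.Perm (Fin (q + 1))) :
    ∃ b : List (Fin q), IsReducedWord b π := by
  have h : coxeterLength π ∈ {k | ∃ b : List (Fin q), b.length = k ∧ reflProd b = π} := by
    obtain ⟨b, hb⟩ := exists_reflProd_eq π
    exact Nat.sInf_mem ⟨b.length, b, rfl, hb⟩
  obtain ⟨b, h1, h2⟩ := h
  exact ⟨b, h2, h1⟩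

theorem coxeterLength_reflProd_le {q : ℕ} (b : List (Fin q)) :
    coxeterLength (reflProd b) ≤ b.length :=
  Nat.sInf_le ⟨b, rfl, rfl⟩

/-- Exchange property. -/
theorem exists_exchange {q : ℕ} (i : Fin q) (b : List (Fin q))
    (h : reflProd b i.succ < reflProd b i.castSucc) :
    ∃ c : List (Fin q), c.length + 1 = b.length ∧ reflProd c = reflProd b * simpleRefl i := by
  induction b with
  | nil =>
    have : i.succ < i.castSucc := h
    exact absurd this (by simp [Fin.lt_def])
  | cons j b ih =>
    have hp : reflProd (j :: b) = simpleRefl j * reflProd b := by simp [reflProd]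
    rcases lt_or_ge (reflProd b i.succ) (reflProd b i.castSucc) with h1 | h1
    · obtain ⟨c, hc, hc'⟩ := ih h1
      refine ⟨j :: c, by simp [hc], ?_⟩
      rw [hp, mul_assoc, ← hc']
      simp [reflProd]
    · have hne : reflProd b i.castSucc ≠ reflProd b i.succ := by
        intro e
        have := (reflProd b).injective e
        simp [Fin.ext_iff] at this
      have hlt : reflProd b i.castSucc < reflProd b i.succ := lt_of_le_of_ne h1 hne
      rw [hp] at h
      have key : reflProd b i.castSucc = j.castSucc ∧ reflProd b i.succ = j.succ := by
        simp only [Equiv.Perm.mul_apply, simpleRefl, Equiv.swap_apply_def] at h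
        generalize reflProd b i.castSucc = x at *
        generalize reflProd b i.succ = y at *
        simp only [Fin.ext_iff, Fin.lt_def, Fin.val_castSucc, Fin.val_succ] at *
        split_ifs at h <;> (try simp only [Fin.val_castSucc, Fin.val_succ] at h) <;> omega
      refine ⟨b, by simp, ?_⟩
      rw [hp]
      have : simpleRefl j = reflProd b * simpleRefl i * (reflProd b)⁻¹ := by
        simp only [simpleRefl]
        rw [← key.1, ← key.2, Equiv.swap_apply_apply]
      rw [this]
      have hs := simpleRefl_mul_self i
      simp only [mul_assoc, inv_mul_cancel, mul_one, hs]

theorem coxeterLength_mul_le {q : ℕ} (π : Equiv.Perm (Fin (q + 1))) (i : Fin q) :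
    coxeterLength (π * simpleRefl i) ≤ coxeterLength π + 1 := by
  obtain ⟨b, hb, hl⟩ := exists_isReducedWord π
  have := coxeterLength_reflProd_le (b ++ [i])
  rw [reflProd_append, reflProd_singleton, hb] at this
  simpa [hl] using this

theorem coxeterLength_of_descent {q : ℕ} (π : Equiv.Perm (Fin (q + 1))) (i : Fin q)
    (h : π i.succ < π i.castSucc) :
    coxeterLength (π * simpleRefl i) + 1 = coxeterLength π := by
  obtain ⟨b, hb, hl⟩ := exists_isReducedWord π
  obtain ⟨c, hc, hc'⟩ := exists_exchange i b (by rwa [hb])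
  have h1 := coxeterLength_reflProd_le c
  rw [hc', hb] at h1
  have h2 := coxeterLength_mul_le (π * simpleRefl i) i
  rw [mul_simpleRefl_mul_self] at h2
  omega

theorem coxeterLength_of_ascent {q : ℕ} (π : Equiv.Perm (Fin (q + 1))) (i : Fin q)
    (h : π i.castSucc < π i.succ) :
    coxeterLength (π * simpleRefl i) = coxeterLength π + 1 := by
  have := coxeterLength_of_descent (π * simpleRefl i) i (by simpa [simpleRefl] using h)
  rw [mul_simpleRefl_mul_self] at this
  exact this.symm

theorem lt_or_lt_apply {q : ℕ} (π : Equiv.Perm (Fin (q + 1))) (i : Fin q) :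
    π i.castSucc < π i.succ ∨ π i.succ < π i.castSucc := by
  apply lt_or_gt_of_ne
  intro e
  have := π.injective e
  simp [Fin.ext_iff] at this

theorem IsReducedWord.snoc {q : ℕ} {b : List (Fin q)} {π : Equiv.Perm (Fin (q + 1))} {i : Fin q}
    (h : π i.succ < π i.castSucc) (hb : IsReducedWord b (π * simpleRefl i)) :
    IsReducedWord (b ++ [i]) π := by
  refine ⟨?_, ?_⟩
  · rw [reflProd_append, reflProd_singleton, hb.1, mul_simpleRefl_mul_self]
  · rw [← coxeterLength_of_descent π i h, ← hb.2]; simp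

theorem IsReducedWord.of_snoc {q : ℕ} {b : List (Fin q)} {π : Equiv.Perm (Fin (q + 1))} {i : Fin q}
    (hb : IsReducedWord (b ++ [i]) π) :
    π i.succ < π i.castSucc ∧ IsReducedWord b (π * simpleRefl i) := by
  obtain ⟨h1, h2⟩ := hb
  have h3 : reflProd b = π * simpleRefl i := by
    rw [← h1, reflProd_append, reflProd_singleton, mul_simpleRefl_mul_self]
  have h4 := coxeterLength_reflProd_le b
  rw [h3] at h4
  simp only [List.length_append, List.length_singleton] at h2
  have hd : π i.succ < π i.castSucc := by
    rcases lt_or_lt_apply π i with h | h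
    · have := coxeterLength_of_ascent π i h
      omega
    · exact h
  have := coxeterLength_of_descent π i hd
  exact ⟨hd, h3, by omega⟩

theorem simpleRefl_castSucc {q : ℕ} (i : Fin q) : simpleRefl i i.castSucc = i.succ :=
  Equiv.swap_apply_left _ _

theorem simpleRefl_succ {q : ℕ} (i : Fin q) : simpleRefl i i.succ = i.castSucc :=
  Equiv.swap_apply_right _ _

theorem simpleRefl_of_ne {q : ℕ} (i : Fin q) (x : Fin (q + 1)) (h1 : (x : ℕ) ≠ i)
    (h2 : (x : ℕ) ≠ i + 1) : simpleRefl i x = x :=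
  Equiv.swap_apply_of_ne_of_ne (fun e => h1 (congrArg Fin.val e))
    (fun e => h2 (congrArg Fin.val e))

theorem mul_simpleRefl {q : ℕ} (π : Equiv.Perm (Fin (q + 1))) (i : Fin q) :
    π * simpleRefl i = Equiv.swap (π i.castSucc) (π i.succ) * π :=
  Equiv.mul_swap_eq_swap_mul _ _ _

theorem simpleRefl_comm {q : ℕ} {i j : Fin q} (h : (i : ℕ) + 2 ≤ j ∨ (j : ℕ) + 2 ≤ i) :
    simpleRefl i * simpleRefl j = simpleRefl j * simpleRefl i := by
  rw [mul_simpleRefl, simpleRefl_of_ne, simpleRefl_of_ne]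
  · rfl
  all_goals simp only [Fin.val_castSucc, Fin.val_succ]; omega

theorem simpleRefl_braid_succ {q : ℕ} {i j : Fin q} (h : (i : ℕ) + 1 = j) :
    simpleRefl i * simpleRefl j * simpleRefl i = simpleRefl j * simpleRefl i * simpleRefl j := by
  have f1 : j.castSucc = i.succ := by simp [Fin.ext_iff, h]
  have g0 : simpleRefl j i.succ = j.succ := by rw [← f1, simpleRefl_castSucc]
  have g2 : simpleRefl j i.castSucc = i.castSucc := by
    apply simpleRefl_of_ne <;> simp only [Fin.val_castSucc] <;> omega
  have g3 : simpleRefl i j.succ = j.succ := by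
    apply simpleRefl_of_ne <;> simp only [Fin.val_succ] <;> omega
  rw [mul_simpleRefl (simpleRefl i) j, mul_simpleRefl (simpleRefl j) i,
    mul_simpleRefl_mul_self, mul_simpleRefl_mul_self, f1, simpleRefl_succ, g0, g2, g3]

theorem simpleRefl_braid {q : ℕ} {i j : Fin q} (h : (i : ℕ) + 1 = j ∨ (j : ℕ) + 1 = i) :
    simpleRefl i * simpleRefl j * simpleRefl i = simpleRefl j * simpleRefl i * simpleRefl j :=
  h.elim simpleRefl_braid_succ fun h => (simpleRefl_braid_succ h).symm

theorem heckeClass_snoc_congr {q : ℕ} {b c : List (Fin q)} (h : heckeClass b = heckeClass c)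
    (d : List (Fin q)) : heckeClass (b ++ d) = heckeClass (c ++ d) := by
  rw [heckeClass_append, heckeClass_append, h]

theorem heckeClass_congr_right {q : ℕ} {b c : List (Fin q)} (h : heckeClass b = heckeClass c)
    (d : List (Fin q)) : heckeClass (d ++ b) = heckeClass (d ++ c) := by
  rw [heckeClass_append, heckeClass_append, h]

/-- Any two reduced words of the same permutation are equivalent. -/
theorem heckeClass_eq_of_isReducedWord {q : ℕ} {b c : List (Fin q)}
    {π : Equiv.Perm (Fin (q + 1))} (hb : IsReducedWord b π) (hc : IsReducedWord c π) :
    heckeClass b = heckeClass c := by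
  induction hn : b.length generalizing b c π with
  | zero =>
    have hc0 : c.length = 0 := by rw [hc.2, ← hb.2, hn]
    rw [List.length_eq_zero_iff.1 hn, List.length_eq_zero_iff.1 hc0]
  | succ n ih =>
    have hcn : c.length = n + 1 := by rw [hc.2, ← hb.2, hn]
    obtain ⟨b, i, rfl⟩ : ∃ b' i, b = b' ++ [i] :=
      ⟨b.dropLast, b.getLast (by rintro rfl; simp at hn), (b.dropLast_concat_getLast _).symm⟩
    obtain ⟨c, j, rfl⟩ : ∃ c' j, c = c' ++ [j] :=
      ⟨c.dropLast, c.getLast (by rintro rfl; simp at hcn), (c.dropLast_concat_getLast _).symm⟩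
    simp only [List.length_append, List.length_singleton, Nat.add_right_cancel_iff] at hn hcn
    obtain ⟨di, hb'⟩ := hb.of_snoc
    obtain ⟨dj, hc'⟩ := hc.of_snoc
    rcases lt_trichotomy (i : ℕ) j with hij | hij | hij
    rotate_left
    · obtain rfl : i = j := Fin.ext hij
      exact heckeClass_snoc_congr (ih hb' hc' hn) _
    all_goals
      by_cases hfar : (i : ℕ) + 2 ≤ j ∨ (j : ℕ) + 2 ≤ i
      · have e1 : (π * simpleRefl i) j.succ < (π * simpleRefl i) j.castSucc := by
          simp only [Equiv.Perm.mul_apply]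
          rw [simpleRefl_of_ne, simpleRefl_of_ne]
          · exact dj
          all_goals simp only [Fin.val_castSucc, Fin.val_succ]; omega
        have e2 : (π * simpleRefl j) i.succ < (π * simpleRefl j) i.castSucc := by
          simp only [Equiv.Perm.mul_apply]
          rw [simpleRefl_of_ne, simpleRefl_of_ne]
          · exact di
          all_goals simp only [Fin.val_castSucc, Fin.val_succ]; omega
        obtain ⟨d, hd⟩ := exists_isReducedWord (π * simpleRefl i * simpleRefl j)
        have hd' : IsReducedWord d (π * simpleRefl j * simpleRefl i) := by
          rwa [mul_assoc, ← simpleRefl_comm hfar, ← mul_assoc]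
        have k1 := ih hb' (hd.snoc e1) hn
        have k2 := ih hc' (hd'.snoc e2) hcn
        rw [heckeClass_snoc_congr k1, heckeClass_snoc_congr k2, List.append_assoc,
          List.append_assoc]
        exact heckeClass_congr_right (heckeClass_comm j i hfar.symm) d
      · have hadj : (i : ℕ) + 1 = j ∨ (j : ℕ) + 1 = i := by omega
        have key : ∀ i j : Fin q, ((i : ℕ) + 1 = j ∨ (j : ℕ) + 1 = i) →
            π i.succ < π i.castSucc → π j.succ < π j.castSucc →
            (π * simpleRefl i) j.succ < (π * simpleRefl i) j.castSucc ∧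
            (π * simpleRefl i * simpleRefl j) i.succ
              < (π * simpleRefl i * simpleRefl j) i.castSucc := by
          intro i j hadj di dj
          simp only [Equiv.Perm.mul_apply]
          rcases hadj with h | h
          · have f1 : j.castSucc = i.succ := by simp [Fin.ext_iff, h]
            have g1 : simpleRefl j i.succ = j.succ := by rw [← f1, simpleRefl_castSucc]
            have g2 : simpleRefl j i.castSucc = i.castSucc := by
              apply simpleRefl_of_ne <;> simp only [Fin.val_castSucc] <;> omega
            have g3 : simpleRefl i j.succ = j.succ := by
              apply simpleRefl_of_ne <;> simp only [Fin.val_succ] <;> omega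
            rw [g1, g2, g3, f1, simpleRefl_succ, simpleRefl_castSucc]
            rw [f1] at dj
            exact ⟨dj.trans di, dj⟩
          · have f1 : i.castSucc = j.succ := by simp [Fin.ext_iff, h]
            have g1 : simpleRefl j i.castSucc = j.castSucc := by rw [f1, simpleRefl_succ]
            have g2 : simpleRefl j i.succ = i.succ := by
              apply simpleRefl_of_ne <;> simp only [Fin.val_succ] <;> omega
            have g3 : simpleRefl i j.castSucc = j.castSucc := by
              apply simpleRefl_of_ne <;> simp only [Fin.val_castSucc] <;> omega
            rw [g1, g2, g3, ← f1, simpleRefl_succ, simpleRefl_castSucc]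
            rw [← f1] at dj
            exact ⟨di.trans dj, dj⟩
        obtain ⟨e1, e1'⟩ := key i j hadj di dj
        obtain ⟨e2, e2'⟩ := key j i hadj.symm dj di
        obtain ⟨d, hd⟩ := exists_isReducedWord
          (π * simpleRefl i * simpleRefl j * simpleRefl i)
        have hd' : IsReducedWord d (π * simpleRefl j * simpleRefl i * simpleRefl j) := by
          have := simpleRefl_braid hadj
          simp only [mul_assoc] at this hd ⊢
          rwa [← this]
        have k1 := ih hb' ((hd.snoc e1').snoc e1) hn
        have k2 := ih hc' ((hd'.snoc e2').snoc e2) hcn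
        rw [heckeClass_snoc_congr k1, heckeClass_snoc_congr k2]
        simp only [List.append_assoc]
        exact heckeClass_congr_right (heckeClass_braid i j) d

/-- Right Demazure action of a letter on permutations. -/
def demStep {q : ℕ} (i : Fin q) (π : Equiv.Perm (Fin (q + 1))) : Equiv.Perm (Fin (q + 1)) :=
  if π i.castSucc < π i.succ then π * simpleRefl i else π

/-- The Demazure product of a word. -/
def dem {q : ℕ} (w : List (Fin q)) : Equiv.Perm (Fin (q + 1)) :=
  w.foldl (fun π i => demStep i π) 1

theorem dem_snoc {q : ℕ} (w : List (Fin q)) (i : Fin q) :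
    dem (w ++ [i]) = demStep i (dem w) := by
  simp [dem]

theorem demStep_idem {q : ℕ} (i : Fin q) (π : Equiv.Perm (Fin (q + 1))) :
    demStep i (demStep i π) = demStep i π := by
  unfold demStep
  split_ifs with h1 h2
  · simp only [Equiv.Perm.mul_apply, simpleRefl_castSucc, simpleRefl_succ] at h2
    exact absurd h1 h2.asymm
  · rfl
  · rfl

theorem demStep_comm {q : ℕ} {i j : Fin q} (h : (i : ℕ) + 2 ≤ j ∨ (j : ℕ) + 2 ≤ i)
    (π : Equiv.Perm (Fin (q + 1))) :
    demStep j (demStep i π) = demStep i (demStep j π) := by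
  have a1 : simpleRefl i j.castSucc = j.castSucc := by
    apply simpleRefl_of_ne <;> simp only [Fin.val_castSucc] <;> omega
  have a2 : simpleRefl i j.succ = j.succ := by
    apply simpleRefl_of_ne <;> simp only [Fin.val_succ] <;> omega
  have a3 : simpleRefl j i.castSucc = i.castSucc := by
    apply simpleRefl_of_ne <;> simp only [Fin.val_castSucc] <;> omega
  have a4 : simpleRefl j i.succ = i.succ := by
    apply simpleRefl_of_ne <;> simp only [Fin.val_succ] <;> omega
  have c := simpleRefl_comm h
  unfold demStep
  by_cases h1 : π i.castSucc < π i.succ <;> by_cases h2 : π j.castSucc < π j.succ <;>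
    simp [h1, h2, a1, a2, a3, a4, Equiv.Perm.mul_apply, mul_assoc, c]

theorem demStep_braid_succ {q : ℕ} {i j : Fin q} (h : (i : ℕ) + 1 = j)
    (π : Equiv.Perm (Fin (q + 1))) :
    demStep i (demStep j (demStep i π)) = demStep j (demStep i (demStep j π)) := by
  have f1 : j.castSucc = i.succ := by simp [Fin.ext_iff, h]
  have g0 : simpleRefl j i.succ = j.succ := by rw [← f1, simpleRefl_castSucc]
  have g1 : simpleRefl j j.succ = i.succ := by rw [← f1, simpleRefl_succ]
  have g2 : simpleRefl j i.castSucc = i.castSucc := by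
    apply simpleRefl_of_ne <;> simp only [Fin.val_castSucc] <;> omega
  have g3 : simpleRefl i j.succ = j.succ := by
    apply simpleRefl_of_ne <;> simp only [Fin.val_succ] <;> omega
  have c := simpleRefl_braid (Or.inl h : (i : ℕ) + 1 = j ∨ (j : ℕ) + 1 = i)
  simp only [mul_assoc] at c
  have n1 := lt_or_lt_apply π i
  have n2 := lt_or_lt_apply π j
  have n3 : π i.castSucc < π j.succ ∨ π j.succ < π i.castSucc := by
    apply lt_or_gt_of_ne
    intro e
    have := π.injective e
    simp only [Fin.ext_iff, Fin.val_castSucc, Fin.val_succ] at this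
    omega
  unfold demStep
  rw [f1] at n2 ⊢
  rcases n1 with n1 | n1 <;> rcases n2 with n2 | n2 <;> rcases n3 with n3 | n3 <;>
    first
    | (exfalso; order)
    | simp [n1, n2, n3, n1.not_gt, n2.not_gt, n3.not_gt, g0, g1, g2, g3, simpleRefl_castSucc,
        simpleRefl_succ, mul_assoc, c]

theorem demStep_braid {q : ℕ} (i j : Fin q) (π : Equiv.Perm (Fin (q + 1))) :
    demStep i (demStep j (demStep i π)) = demStep j (demStep i (demStep j π)) := by
  by_cases hfar : (i : ℕ) + 2 ≤ j ∨ (j : ℕ) + 2 ≤ i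
  · rw [demStep_comm hfar, demStep_idem, demStep_comm hfar.symm, demStep_idem,
      demStep_comm hfar]
  · rcases lt_trichotomy (i : ℕ) j with h | h | h
    · exact demStep_braid_succ (by omega) π
    · rw [Fin.ext h]
    · exact (demStep_braid_succ (by omega) π).symm

/-- `demStep i` as an element of the endomorphism monoid. -/
def demEnd {q : ℕ} (i : Fin q) : (Function.End (Equiv.Perm (Fin (q + 1))))ᵐᵒᵖ :=
  MulOpposite.op (demStep i : Function.End (Equiv.Perm (Fin (q + 1))))

theorem demEnd_mul {q : ℕ} (x : (Function.End (Equiv.Perm (Fin (q + 1))))ᵐᵒᵖ) (i : Fin q)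
    (π : Equiv.Perm (Fin (q + 1))) : (x * demEnd i).unop π = demStep i (x.unop π) :=
  rfl

theorem demEnd_ext {q : ℕ} {x y : (Function.End (Equiv.Perm (Fin (q + 1))))ᵐᵒᵖ}
    (h : ∀ π, x.unop π = y.unop π) : x = y :=
  MulOpposite.unop_injective (funext h)

/-- The right action of the `0`-Hecke monoid on permutations. -/
def demHom (q : ℕ) : HeckeMonoid q →* (Function.End (Equiv.Perm (Fin (q + 1))))ᵐᵒᵖ :=
  PresentedMonoid.lift (M := (Function.End (Equiv.Perm (Fin (q + 1))))ᵐᵒᵖ)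
    (rels := HeckeRel q) demEnd (by
      intro a b h
      cases h with
      | idem i =>
        simp only [map_mul, FreeMonoid.lift_eval_of]
        exact demEnd_ext fun π => demStep_idem i π
      | braid i j =>
        simp only [map_mul, FreeMonoid.lift_eval_of]
        exact demEnd_ext fun π => demStep_braid i j π
      | comm i j h =>
        simp only [map_mul, FreeMonoid.lift_eval_of]
        exact demEnd_ext fun π => demStep_comm h π)

theorem demHom_heckeClass {q : ℕ} (w : List (Fin q)) :
    (demHom q (heckeClass w)).unop 1 = dem w := by
  induction w using List.reverseRecOn with
  | nil => rfl
  | append_singleton w i ih =>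
    have h : demHom q (heckeClass [i]) = demEnd i := rfl
    rw [heckeClass_append, map_mul, dem_snoc, ← ih, h, demEnd_mul]

theorem dem_eq_of_heckeClass_eq {q : ℕ} {v w : List (Fin q)}
    (h : heckeClass v = heckeClass w) : dem v = dem w := by
  rw [← demHom_heckeClass, ← demHom_heckeClass, h]

theorem dem_of_isReducedWord {q : ℕ} {b : List (Fin q)} {π : Equiv.Perm (Fin (q + 1))}
    (hb : IsReducedWord b π) : dem b = π := by
  induction b using List.reverseRecOn generalizing π with
  | nil => exact hb.1
  | append_singleton b i ih =>
    obtain ⟨hd, hb'⟩ := hb.of_snoc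
    rw [dem_snoc, ih hb', demStep, if_pos, mul_simpleRefl_mul_self]
    simpa only [Equiv.Perm.mul_apply, simpleRefl_castSucc, simpleRefl_succ] using hd

theorem isHeckeWord_dem {q : ℕ} (w : List (Fin q)) : IsHeckeWord w (dem w) := by
  induction w using List.reverseRecOn with
  | nil =>
    intro b hb
    have h0 : IsReducedWord ([] : List (Fin q)) (1 : Equiv.Perm (Fin (q + 1))) := by
      refine ⟨rfl, ?_⟩
      have := coxeterLength_reflProd_le ([] : List (Fin q))
      exact (Nat.le_zero.1 this).symm
    exact heckeClass_eq_of_isReducedWord h0 hb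
  | append_singleton w i ih =>
    intro b hb
    rw [dem_snoc] at hb
    unfold demStep at hb
    split_ifs at hb with h
    · obtain ⟨c, hc⟩ := exists_isReducedWord (dem w)
      have hc' : IsReducedWord (c ++ [i]) (dem w * simpleRefl i) := by
        apply IsReducedWord.snoc
        · simpa only [Equiv.Perm.mul_apply, simpleRefl_castSucc, simpleRefl_succ] using h
        · rwa [mul_simpleRefl_mul_self]
      rw [heckeClass_snoc_congr (ih c hc)]
      exact heckeClass_eq_of_isReducedWord hc' hb
    · have hd := (lt_or_lt_apply (dem w) i).resolve_left h
      obtain ⟨c, hc⟩ := exists_isReducedWord (dem w * simpleRefl i)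
      have hc' := hc.snoc hd
      rw [heckeClass_snoc_congr (ih _ hc'), List.append_assoc]
      exact (heckeClass_congr_right (heckeClass_idem i) c).trans
        (heckeClass_eq_of_isReducedWord hc' hb)

/-- Every word is a Hecke word for exactly one permutation. -/
theorem existsUnique_isHeckeWord {q : ℕ} (w : List (Fin q)) :
    ∃! π : Equiv.Perm (Fin (q + 1)), IsHeckeWord w π := by
  refine ⟨dem w, isHeckeWord_dem w, fun π hπ => ?_⟩
  obtain ⟨b, hb⟩ := exists_isReducedWord π
  rw [dem_eq_of_heckeClass_eq (hπ b hb), dem_of_isReducedWord hb]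

/-- The permutation `W(w) ∈ S_{q+1}` of a word `w`: the unique permutation for which `w` is a
Hecke word. -/
noncomputable def heckePerm {q : ℕ} (w : List (Fin q)) : Equiv.Perm (Fin (q + 1)) :=
  (existsUnique_isHeckeWord w).choose

theorem heckePerm_eq_iff {q : ℕ} (w : List (Fin q)) (π : Equiv.Perm (Fin (q + 1))) :
    heckePerm w = π ↔ IsHeckeWord w π := by
  have h := (existsUnique_isHeckeWord w).choose_spec
  exact ⟨fun e => e ▸ h.1, fun hπ => (h.2 π hπ).symm⟩

/-! ### Longest strictly monotone subsequences -/

open Classical in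
/-- `LIS(w)`: the largest size of a set of positions on which `w` is strictly increasing. -/
noncomputable def LIS {n q : ℕ} (w : Fin n → Fin q) : ℕ :=
  ((Finset.univ : Finset (Finset (Fin n))).filter
    fun s : Finset (Fin n) => StrictMonoOn w (s : Set (Fin n))).sup Finset.card

open Classical in
/-- `LDS(w)`: the largest size of a set of positions on which `w` is strictly decreasing. -/
noncomputable def LDS {n q : ℕ} (w : Fin n → Fin q) : ℕ :=
  ((Finset.univ : Finset (Finset (Fin n))).filter
    fun s : Finset (Fin n) => StrictAntiOn w (s : Set (Fin n))).sup Finset.card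

end HeckeES

/-! The proof is a bare form of Hecke insertion: only the first row is ever built, and recursion on
the bumped letters stands in for the rest of the tableau. Every word `w` can be rewritten as `u ++
R`, with `R` strictly increasing and every letter of `u` larger than some letter of `R`
(`exists_word_insertion`). The rewriting uses only moves that preserve the Hecke class and create no
longer monotone subsequence in either direction (`Reduces`).

Suppose LIS ≤ a and LDS ≤ b. The row `R` is an increasing subsequence, so it has at most a letters,
and also at most as many as the alphabet allows. A decreasing subsequence of `u` extends by a letter
of `R`, so `u` has LDS ≤ b - 1. The letters of `u` exceed a letter of `R`, so they avoid the
smallest letter of the alphabet. Each letter of `R` raises the Coxeter length of the Demazure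
product `dem` by at most one. Induction on b then bounds the length by the sum, over the b rows, of
the minimum of a and the size of the remaining alphabet (`coxeterLength_dem_le`). This is the second
form of the common value. The permutation of `w` is `dem w`, so the bound applies to it. -/

namespace HeckeES

/-! ### Comparing chains of two words -/

/-- Every `r`-chain occurring as a sublist of `v` can be replaced by an `r`-chain of the same length
occurring in `w`, with no weaker comparisons to outside elements. -/
def ChainDom {α : Type*} (r : α → α → Prop) (w v : List α) : Prop :=
  ∀ t : List α, t.Sublist v → t.Pairwise r → ∃ t' : List α, t'.Sublist w ∧ t'.Pairwise r ∧
    t'.length = t.length ∧ (∀ z, (∀ y ∈ t, r z y) → ∀ x ∈ t', r z x) ∧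
      (∀ z, (∀ y ∈ t, r y z) → ∀ x ∈ t', r x z)

theorem ChainDom.refl {α : Type*} (r : α → α → Prop) (w : List α) : ChainDom r w w :=
  fun t h h' => ⟨t, h, h', rfl, fun _ h => h, fun _ h => h⟩

theorem ChainDom.trans {α : Type*} {r : α → α → Prop} {u v w : List α} (h : ChainDom r u v)
    (h' : ChainDom r v w) : ChainDom r u w := by
  intro t ht hp
  obtain ⟨t', h1, h2, h3, h4, h5⟩ := h' t ht hp
  obtain ⟨t'', k1, k2, k3, k4, k5⟩ := h t' h1 h2
  exact ⟨t'', k1, k2, k3.trans h3, fun z hz => k4 z (h4 z hz), fun z hz => k5 z (h5 z hz)⟩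

/-- Comparing lengths alone would not survive concatenation; the clauses of `ChainDom` on outside
elements are there to let moves be applied inside a longer word. -/
theorem ChainDom.append {α : Type*} {r : α → α → Prop} {w v w' v' : List α}
    (h : ChainDom r w v) (h' : ChainDom r w' v') : ChainDom r (w ++ w') (v ++ v') := by
  intro t ht hp
  obtain ⟨t₁, t₂, rfl, ht₁, ht₂⟩ := List.sublist_append_iff.1 ht
  obtain ⟨hp₁, hp₂, hp₃⟩ := List.pairwise_append.1 hp
  obtain ⟨s₁, a1, a2, a3, a4, a5⟩ := h t₁ ht₁ hp₁
  obtain ⟨s₂, b1, b2, b3, b4, b5⟩ := h' t₂ ht₂ hp₂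
  refine ⟨s₁ ++ s₂, a1.append b1, List.pairwise_append.2 ⟨a2, b2, fun x hx y hy => ?_⟩,
    by simp [a3, b3], fun z hz x hx => ?_, fun z hz x hx => ?_⟩
  -- The halves are replaced one after the other: `b4` compares `t₁` with `s₂`, then `a5` compares
  -- `s₁` with `s₂`.
  · exact a5 y (fun x' hx' => b4 x' (fun y' hy' => hp₃ x' hx' y' hy') y hy) x hx
  · rcases List.mem_append.1 hx with hx | hx
    · exact a4 z (fun y hy => hz y (List.mem_append_left _ hy)) x hx
    · exact b4 z (fun y hy => hz y (List.mem_append_right _ hy)) x hx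
  · rcases List.mem_append.1 hx with hx | hx
    · exact a5 z (fun y hy => hz y (List.mem_append_left _ hy)) x hx
    · exact b5 z (fun y hy => hz y (List.mem_append_right _ hy)) x hx

/-- All `r`-chains of `w` have length at most `k`. -/
def ChainBound {α : Type*} (r : α → α → Prop) (w : List α) (k : ℕ) : Prop :=
  ∀ t : List α, t.Sublist w → t.Pairwise r → t.length ≤ k

theorem ChainBound.of_chainDom {α : Type*} {r : α → α → Prop} {w v : List α} {k : ℕ}
    (hw : ChainBound r w k) (h : ChainDom r w v) : ChainBound r v k := by
  intro t ht hp
  obtain ⟨t', h1, h2, h3, -⟩ := h t ht hp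
  exact h3 ▸ hw t' h1 h2

theorem ChainBound.sublist {α : Type*} {r : α → α → Prop} {w v : List α} {k : ℕ}
    (hw : ChainBound r w k) (h : v.Sublist w) : ChainBound r v k :=
  fun t ht hp => hw t (ht.trans h) hp

/-! ### Elementary moves on words -/

/-- `v` is Hecke equivalent to `w`, and has no longer strictly monotone subsequences. -/
structure Reduces {q : ℕ} (w v : List (Fin q)) : Prop where
  hecke : heckeClass w = heckeClass v
  inc : ChainDom (· < ·) w v
  dec : ChainDom (· > ·) w v

theorem Reduces.refl {q : ℕ} (w : List (Fin q)) : Reduces w w :=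
  ⟨rfl, ChainDom.refl _ w, ChainDom.refl _ w⟩

theorem Reduces.trans {q : ℕ} {u v w : List (Fin q)} (h : Reduces u v) (h' : Reduces v w) :
    Reduces u w :=
  ⟨h.hecke.trans h'.hecke, h.inc.trans h'.inc, h.dec.trans h'.dec⟩

theorem Reduces.append {q : ℕ} {w v w' v' : List (Fin q)} (h : Reduces w v)
    (h' : Reduces w' v') : Reduces (w ++ w') (v ++ v') :=
  ⟨by rw [heckeClass_append, heckeClass_append, h.hecke, h'.hecke],
    h.inc.append h'.inc, h.dec.append h'.dec⟩

theorem Reduces.append_left {q : ℕ} {w v : List (Fin q)} (p : List (Fin q)) (h : Reduces w v) :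
    Reduces (p ++ w) (p ++ v) :=
  (Reduces.refl p).append h

theorem Reduces.append_right {q : ℕ} {w v : List (Fin q)} (h : Reduces w v) (p : List (Fin q)) :
    Reduces (w ++ p) (v ++ p) :=
  h.append (Reduces.refl p)

theorem ChainDom.of_sublist_or {α : Type*} {r : α → α → Prop} {w v : List α}
    (h : ∀ t : List α, t.Sublist v → t.Pairwise r → t.Sublist w ∨
      ∃ t' : List α, t'.Sublist w ∧ t'.Pairwise r ∧
    t'.length = t.length ∧ (∀ z, (∀ y ∈ t, r z y) → ∀ x ∈ t', r z x) ∧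
      (∀ z, (∀ y ∈ t, r y z) → ∀ x ∈ t', r x z)) : ChainDom r w v := by
  intro t ht hp
  rcases h t ht hp with h | h
  · exact ⟨t, h, hp, rfl, fun _ h => h, fun _ h => h⟩
  · exact h

theorem sublist_triple {α : Type*} {t : List α} {x y z : α} (h : t.Sublist [x, y, z]) :
    t = [] ∨ t = [x] ∨ t = [y] ∨ t = [z] ∨ t = [x, y] ∨ t = [x, z] ∨ t = [y, z] ∨
      t = [x, y, z] := by
  have := List.mem_sublists.2 h
  simp [List.sublists] at this
  tauto

theorem Reduces.idem {q : ℕ} (x : Fin q) : Reduces [x, x] [x] := by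
  refine ⟨heckeClass_idem x, ?_, ?_⟩ <;>
  · refine ChainDom.of_sublist_or fun t ht _ => Or.inl (ht.trans ?_)
    simp

/-- The monotone chains of the new word, y, x, yx and xy, all occur in the old one. The letters need
not be consecutive, as the braid relation holds for all pairs. -/
theorem Reduces.braid {q : ℕ} {x y : Fin q} (h : x < y) : Reduces [x, y, x] [y, x, y] := by
  refine ⟨heckeClass_braid x y, ?_, ?_⟩ <;>
  · refine ChainDom.of_sublist_or fun t ht hp => Or.inl ?_
    rcases sublist_triple ht with rfl | rfl | rfl | rfl | rfl | rfl | rfl | rfl <;>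
      simp_all [List.sublist_cons_iff, h.asymm]

/-- A Knuth move. The letter y strictly between x and z forces z ≥ x + 2, so x and z commute, and y
also stands in for x in the one new chain. -/
theorem Reduces.swap_right {q : ℕ} {x y z : Fin q} (h : x < y) (h' : y < z) :
    Reduces [y, z, x] [y, x, z] := by
  refine ⟨heckeClass_congr_right (heckeClass_comm z x (Or.inr ?_)) [y], ?_, ?_⟩
  · simp only [Fin.lt_def] at h h'; omega
  all_goals
    refine ChainDom.of_sublist_or fun t ht hp => ?_
    rcases sublist_triple ht with rfl | rfl | rfl | rfl | rfl | rfl | rfl | rfl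
  any_goals (left; simp_all [List.sublist_cons_iff]; done)
  -- The new increasing chain x < z is replaced by y < z: whatever is below x is below y, and the
  -- top is unchanged.
  · exact Or.inr ⟨[y, z], by simp, by simpa using h', rfl,
      fun u hu => by simpa using ⟨(hu x (by simp)).trans h, hu z (by simp)⟩,
      fun u hu => by simpa using ⟨h'.trans (hu z (by simp)), hu z (by simp)⟩⟩
  all_goals
    exfalso
    simp only [List.pairwise_cons, List.mem_cons, List.not_mem_nil, or_false, forall_eq_or_imp,
      forall_eq] at hp
    have := h.trans h'
    first | exact hp.1.1.asymm h | exact hp.1.asymm this | exact hp.2.1.asymm this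

/-- The other Knuth move: the witness y now stands to the right of the commuting pair, and the new
chain is decreasing. -/
theorem Reduces.swap_left {q : ℕ} {x y z : Fin q} (h : x < y) (h' : y < z) :
    Reduces [x, z, y] [z, x, y] := by
  refine ⟨heckeClass_snoc_congr (heckeClass_comm x z (Or.inl ?_)) [y], ?_, ?_⟩
  · simp only [Fin.lt_def] at h h'; omega
  all_goals
    refine ChainDom.of_sublist_or fun t ht hp => ?_
    rcases sublist_triple ht with rfl | rfl | rfl | rfl | rfl | rfl | rfl | rfl
  any_goals (left; simp_all [List.sublist_cons_iff]; done)
  rotate_right 2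
  -- The new decreasing chain z > x is replaced by z > y.
  · exact Or.inr ⟨[z, y], by simp, by simpa using h', rfl,
      fun u hu => by simpa using ⟨hu z (by simp), h'.trans (hu z (by simp))⟩,
      fun u hu => by simpa using ⟨hu z (by simp), (hu x (by simp)).trans h⟩⟩
  all_goals
    exfalso
    simp only [List.pairwise_cons, List.mem_cons, List.not_mem_nil, or_false, forall_eq_or_imp,
      forall_eq] at hp
    have := h.trans h'
    first | exact hp.1.1.asymm this | exact hp.1.asymm this | exact hp.2.1.asymm h

/-! ### Hecke insertion into a row -/

/-- A small letter travels left through an increasing row until it meets the entry it bumps. -/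
theorem Reduces.travel {q : ℕ} {x y : Fin q} (C : List (Fin q)) (h : x < y)
    (hC : (y :: C).Pairwise (· < ·)) : Reduces (y :: C ++ [x]) (y :: x :: C) := by
  induction C generalizing y with
  | nil => exact Reduces.refl _
  | cons c C ih =>
    have hyc : y < c := (List.pairwise_cons.1 hC).1 c (by simp)
    -- By induction x already stands just after c; then y c x becomes y x c, with y as the witness.
    exact ((ih (h.trans hyc) (List.pairwise_cons.1 hC).2).append_left [y]).trans
      ((Reduces.swap_right h hyc).append_right C)

/-- Hecke insertion of a letter into a strictly increasing row, with at most one letter bumped. -/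
theorem exists_row_insertion {q : ℕ} (x : Fin q) (R : List (Fin q)) (hR : R.Pairwise (· < ·)) :
    ∃ o R' : List (Fin q), R'.Pairwise (· < ·) ∧ Reduces (R ++ [x]) (o ++ R') ∧
      (o = [] ∨ ∃ y, o = [y]) ∧ (∀ y ∈ o, ∃ m ∈ R', m < y) ∧ (∀ z ∈ R, ∃ m ∈ R', m ≤ z) ∧
      ∀ y ∈ o ++ R', y ∈ R ++ [x] := by
  induction R with
  | nil => exact ⟨[], [x], by simp, Reduces.refl _, by simp, by simp, by simp, by simp⟩
  | cons c R ih =>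
    obtain ⟨hc, hR'⟩ := List.pairwise_cons.1 hR
    rcases lt_trichotomy x c with h | rfl | h
    · refine ⟨[c], x :: R, List.pairwise_cons.2 ⟨fun y hy => h.trans (hc y hy), hR'⟩,
        Reduces.travel R h hR, by simp, by simpa using Or.inl h, ?_, by simp; tauto⟩
      intro z hz
      rcases List.mem_cons.1 hz with rfl | hz
      · exact ⟨x, by simp, h.le⟩
      · exact ⟨z, by simp [hz], le_rfl⟩
    · rcases R with - | ⟨y, C⟩
      · exact ⟨[], [x], by simp, Reduces.idem x, by simp, by simp, by simp, by simp⟩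
      · have hxy : x < y := hc y (by simp)
        refine ⟨[y], x :: y :: C, hR, ?_, by simp, by simpa using Or.inl hxy,
          fun z hz => ⟨z, hz, le_rfl⟩, by simp; tauto⟩
        -- The row already starts with x, so it is left unchanged and its next letter y is bumped: x
        -- y C x → x y x C → y x y C.
        exact ((Reduces.travel C hxy hR').append_left [x]).trans
          ((Reduces.braid hxy).append_right C)
    · obtain ⟨o, R', h1, h2, h3, h4, h5, h6⟩ := ih hR'
      have hc' : ∀ y ∈ o ++ R', c < y := by
        intro y hy
        rcases List.mem_append.1 (h6 y hy) with hy | hy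
        · exact hc y hy
        · rwa [List.mem_singleton.1 hy]
      have hpw : (c :: R').Pairwise (· < ·) :=
        List.pairwise_cons.2 ⟨fun y hy => hc' y (List.mem_append_right _ hy), h1⟩
      refine ⟨o, c :: R', hpw, (h2.append_left [c]).trans ?_, h3,
        fun y hy => ⟨c, by simp, hc' y (List.mem_append_left _ hy)⟩, ?_, ?_⟩
      · rcases h3 with rfl | ⟨y, rfl⟩
        · exact Reduces.refl _
        · obtain ⟨m, hm, hmy⟩ := h4 y (by simp)
          rcases R' with - | ⟨d, D⟩
          · simp at hm
          · have hdm : d ≤ m := by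
              rcases List.mem_cons.1 hm with rfl | hm
              · exact le_rfl
              · exact ((List.pairwise_cons.1 h1).1 m hm).le
            -- The bumped letter y leaves past c: c y d → y c d, with the head d of the new row as
            -- witness, since c < d < y.
            exact (Reduces.swap_left (hc' d (by simp)) (hdm.trans_lt hmy)).append_right D
      · intro z hz
        rcases List.mem_cons.1 hz with rfl | hz
        · exact ⟨z, by simp, le_rfl⟩
        · obtain ⟨m, hm, hmz⟩ := h5 z hz
          exact ⟨m, by simp [hm], hmz⟩
      · intro y hy
        have := h6 y
        simp only [List.mem_append, List.mem_cons, List.cons_append, List.not_mem_nil,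
          or_false] at this hy ⊢
        tauto

/-- Inserting a word letter by letter into an empty row: `u` is the word of bumped letters. -/
theorem exists_word_insertion {q : ℕ} (w : List (Fin q)) :
    ∃ u R : List (Fin q), R.Pairwise (· < ·) ∧ Reduces w (u ++ R) ∧
      (∀ y ∈ u, ∃ m ∈ R, m < y) ∧ ∀ y ∈ u ++ R, y ∈ w := by
  induction w using List.reverseRecOn with
  | nil => exact ⟨[], [], by simp, Reduces.refl _, by simp, by simp⟩
  | append_singleton w x ih =>
    obtain ⟨u, R, h1, h2, h3, h4⟩ := ih
    obtain ⟨o, R', k1, k2, -, k4, k5, k6⟩ := exists_row_insertion x R h1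
    refine ⟨u ++ o, R', k1, (h2.append_right [x]).trans ?_, ?_, ?_⟩
    · rw [List.append_assoc, List.append_assoc]
      exact k2.append_left u
    · intro y hy
      rcases List.mem_append.1 hy with hy | hy
      · obtain ⟨m, hm, hmy⟩ := h3 y hy
        -- A later insertion may replace m, but only in favour of some m' ≤ m, so letters bumped
        -- earlier stay above the row.
        obtain ⟨m', hm', hmm⟩ := k5 m hm
        exact ⟨m', hm', hmm.trans_lt hmy⟩
      · exact k4 y hy
    · intro y hy
      have a1 := h4 y
      have a2 := k6 y
      simp only [List.mem_append] at a1 a2 hy ⊢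
      tauto

/-! ### Bounding the length row by row -/

theorem coxeterLength_demStep_le {q : ℕ} (i : Fin q) (π : Equiv.Perm (Fin (q + 1))) :
    coxeterLength (demStep i π) ≤ coxeterLength π + 1 := by
  unfold demStep
  split_ifs
  · exact coxeterLength_mul_le π i
  · omega

theorem coxeterLength_dem_append_le {q : ℕ} (u v : List (Fin q)) :
    coxeterLength (dem (u ++ v)) ≤ coxeterLength (dem u) + v.length := by
  induction v using List.reverseRecOn with
  | nil => simp
  | append_singleton v i ih =>
    rw [← List.append_assoc, dem_snoc, List.length_append, List.length_singleton]
    have := coxeterLength_demStep_le i (dem (u ++ v))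
    omega

/-- The letters are distinct values in the interval from j to q - 1. If j ≥ q this interval is
empty, in agreement with the truncated subtraction. -/
theorem length_le_of_pairwise_lt {q j : ℕ} {R : List (Fin q)} (hR : R.Pairwise (· < ·))
    (hj : ∀ x ∈ R, j ≤ (x : ℕ)) : R.length ≤ q - j := by
  have hnd : (R.map Fin.val).Nodup :=
    List.Nodup.map Fin.val_injective (hR.imp (S := (· ≠ ·)) fun h => ne_of_lt h)
  have hsub : (R.map Fin.val).toFinset ⊆ Finset.Ico j q := by
    intro k hk
    obtain ⟨x, hx, rfl⟩ := List.mem_map.1 (List.mem_toFinset.1 hk)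
    exact Finset.mem_Ico.2 ⟨hj x hx, x.2⟩
  have := Finset.card_le_card hsub
  rwa [List.toFinset_card_of_nodup hnd, List.length_map, Nat.card_Ico] at this

/-- Each row of the insertion contributes at most `a` letters, taken from a shrinking alphabet. -/
theorem coxeterLength_dem_le {q : ℕ} (a b j : ℕ) (w : List (Fin q))
    (hj : ∀ x ∈ w, j ≤ (x : ℕ)) (hinc : ChainBound (· < ·) w a)
    (hdec : ChainBound (· > ·) w b) :
    coxeterLength (dem w) ≤ ∑ i ∈ Finset.range b, min a (q - (j + i)) := by
  induction b generalizing j w with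
  | zero =>
    have hw : w = [] := by
      rcases w with - | ⟨x, w⟩
      · rfl
      · have := hdec [x] (by simp) (by simp)
        simp at this
    subst hw
    simpa [reflProd, dem] using coxeterLength_reflProd_le ([] : List (Fin q))
  | succ b ih =>
    obtain ⟨u, R, h1, h2, h3, h4⟩ := exists_word_insertion w
    have hi := hinc.of_chainDom h2.inc
    have hd := hdec.of_chainDom h2.dec
    have hu := ih (j + 1) u
      (fun y hy => by
        obtain ⟨m, hm, hmy⟩ := h3 y hy
        have := hj m (h4 m (List.mem_append_right _ hm))
        have : (m : ℕ) < y := hmy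
        omega)
      (hi.sublist (List.sublist_append_left u R))
      (fun t ht hp => by
        rcases t.eq_nil_or_concat with rfl | ⟨t, y, rfl⟩
        · simp
        · obtain ⟨m, hm, hmy⟩ := h3 y (ht.subset (by simp))
          -- A decreasing chain of `u` with last letter y continues with a letter m < y of `R`, so
          -- its length plus one is at most b + 1.
          have hlen := hd (t ++ [y] ++ [m])
            ((by simpa using ht : (t ++ [y]).Sublist u).append (List.singleton_sublist.2 hm)) (by
              rw [List.concat_eq_append] at hp
              refine List.pairwise_append.2 ⟨hp, by simp, fun x hx z hz => ?_⟩
              rw [List.mem_singleton.1 hz]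
              rcases List.mem_append.1 hx with hx | hx
              · exact hmy.trans ((List.pairwise_append.1 hp).2.2 x hx y (by simp))
              · rwa [List.mem_singleton.1 hx])
          simpa using hlen)
    have hR1 : R.length ≤ a := hi R (List.sublist_append_right u R) h1
    have hR2 : R.length ≤ q - j :=
      length_le_of_pairwise_lt h1 fun x hx => hj x (h4 x (List.mem_append_right _ hx))
    have happ := coxeterLength_dem_append_le u R
    -- The term i = 0 is split off for `R`; the shifted terms match the induction hypothesis for
    -- `u`.
    rw [dem_eq_of_heckeClass_eq h2.hecke, Finset.sum_range_succ']
    have e : ∀ i, j + 1 + i = j + (i + 1) := fun i => by ring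
    simp only [e] at hu
    have := le_min hR1 hR2
    rw [add_zero]
    omega

/-! ### From sublists to sets of positions -/

theorem exists_finset_of_sublist_ofFn {n : ℕ} {α : Type*} {r : α → α → Prop} {w : Fin n → α}
    {t : List α} (ht : t.Sublist (List.ofFn w)) (hp : t.Pairwise r) :
    ∃ s : Finset (Fin n), s.card = t.length ∧
      ∀ i ∈ s, ∀ j ∈ s, i < j → r (w i) (w j) := by
  obtain ⟨f, hf⟩ := List.sublist_iff_exists_fin_orderEmbedding_get_eq.1 ht
  let g : Fin t.length ↪o Fin n :=
    f.trans (Fin.castOrderIso (List.length_ofFn (f := w))).toOrderEmbedding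
  have hg : ∀ i, w (g i) = t.get i := fun i => by
    rw [hf, List.get_ofFn]; rfl
  refine ⟨Finset.univ.map g.toEmbedding, by simp, ?_⟩
  intro i hi j hj hij
  obtain ⟨i, -, rfl⟩ := Finset.mem_map.1 hi
  obtain ⟨j, -, rfl⟩ := Finset.mem_map.1 hj
  have hlt : i < j := g.lt_iff_lt.1 hij
  have := List.pairwise_iff_get.1 hp i j hlt
  rw [← hg, ← hg] at this
  exact this

theorem chainBound_LIS {n q : ℕ} (w : Fin n → Fin q) :
    ChainBound (· < ·) (List.ofFn w) (LIS w) := by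
  classical
  intro t ht hp
  obtain ⟨s, hs, h⟩ := exists_finset_of_sublist_ofFn ht hp
  rw [← hs]
  exact Finset.le_sup (f := Finset.card) (Finset.mem_filter.2 ⟨Finset.mem_univ _,
    fun i hi j hj hij => h i (by simpa using hi) j (by simpa using hj) hij⟩)

theorem chainBound_LDS {n q : ℕ} (w : Fin n → Fin q) :
    ChainBound (· > ·) (List.ofFn w) (LDS w) := by
  classical
  intro t ht hp
  obtain ⟨s, hs, h⟩ := exists_finset_of_sublist_ofFn ht hp
  rw [← hs]
  exact Finset.le_sup (f := Finset.card) (Finset.mem_filter.2 ⟨Finset.mem_univ _,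
    fun i hi j hj hij => h i (by simpa using hi) j (by simpa using hj) hij⟩)

/-! ### The common value and the conclusion -/

/-- Both sums count the lattice points `(i, j)` of the box with `i + j ≤ q + 1`. -/
theorem sum_min_comm (a b q : ℕ) :
    ∑ i ∈ Finset.Icc 1 a, min b (q + 1 - i) = ∑ j ∈ Finset.Icc 1 b, min a (q + 1 - j) := by
  have key : ∀ b i : ℕ, min b (q + 1 - i) =
      ∑ j ∈ Finset.Icc 1 b, if i + j ≤ q + 1 then 1 else 0 := by
    intro b i
    rw [← Finset.card_filter]
    -- When i > q + 1 the truncated difference is 0, and indeed no j ≥ 1 satisfies the condition.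
    have : (Finset.Icc 1 b).filter (fun j => i + j ≤ q + 1) =
        Finset.Icc 1 (min b (q + 1 - i)) := by
      ext j
      simp only [Finset.mem_filter, Finset.mem_Icc]
      omega
    rw [this, Nat.card_Icc, Nat.add_sub_cancel]
  rw [Finset.sum_congr rfl fun i _ => key b i, Finset.sum_congr rfl fun j _ => key a j,
    Finset.sum_comm]
  simp only [add_comm]

end HeckeES

theorem proposition3p2 {n q : ℕ} (w : Fin n → Fin q) (a b : ℕ)
    (ha : 1 ≤ a) (haq : a < q) (hb : 1 ≤ b) (hbq : b < q) :
    (∑ i ∈ Finset.Icc 1 a, min b (q + 1 - i) = ∑ j ∈ Finset.Icc 1 b, min a (q + 1 - j)) ∧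
    (∑ i ∈ Finset.Icc 1 a, min b (q + 1 - i)
        < HeckeES.coxeterLength (HeckeES.heckePerm (List.ofFn w)) →
      a < HeckeES.LIS w ∨ b < HeckeES.LDS w) := by
  refine ⟨HeckeES.sum_min_comm a b q, fun h => ?_⟩
  by_contra! hcon
  rw [(HeckeES.heckePerm_eq_iff _ _).2 (HeckeES.isHeckeWord_dem _),
    HeckeES.sum_min_comm a b q] at h
  have hle := HeckeES.coxeterLength_dem_le a b 0 (List.ofFn w) (fun _ _ => Nat.zero_le _)
    (fun t ht hp => (HeckeES.chainBound_LIS w t ht hp).trans hcon.1)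
    (fun t ht hp => (HeckeES.chainBound_LDS w t ht hp).trans hcon.2)
  -- The index j starts at 1 and i at 0, so q + 1 - j becomes q - i; the 0 is the initial lower
  -- bound on letters, the whole alphabet being available.
  have e : ∑ j ∈ Finset.Icc 1 b, min a (q + 1 - j) =
      ∑ i ∈ Finset.range b, min a (q - (0 + i)) := by
    rw [← Finset.Ico_succ_right_eq_Icc, Finset.sum_Ico_eq_sum_range]
    refine Finset.sum_congr (by simp) fun i _ => ?_
    congr 1
    omega
  omega
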